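/- Let $\Omega_0\subset\mathbb C$ be a bounded, simply connected open set with boundary of class $C^2$. Let $d\in\mathbb N$, let $\gamma_1,\dots,\gamma_d:\Omega_0\to\Omega_0$ be holomorphic maps which extend continuously to $\overline{\Omega_0}$ and satisfy $\overline{\gamma_j(\Omega_0)}\subset\Omega_0$, and let $G:\Omega_0\to\mathbb C$ be holomorphic and extend continuously to $\overline{\Omega_0}$. For $N\in\mathbb N$ let $H^2(\Omega_0,\mathbb C^N)$ be the Bergman space of holomorphic functions $F:\Omega_0\to\mathbb C^N$ with $\int_{\Omega_0}\|F(z)\|^2\,dm(z)<\infty$, where $m$ is Lebesgue measure and $\|\cdot\|$ the Hermitian norm. For $N\times N$ permutation matrices $U_1,\dots,U_d$, let $\mathscr L_N$ be the operator on $H^2(\Omega_0,\mathbb C^N)$ given by $$\mathscr L_N(F)(z)=\sum_{j=1}^d e^{G(\gamma_j z)}\,U_jF(\gamma_j z).$$ Then there is a constant $C_0>0$, depending only on $\Omega_0$, $G$ and $\gamma_1,\dots,\gamma_d$, such that for every $N$, every choice of the permutation matrices $U_1,\dots,U_d$ and every $r>0$, the number of eigenvalues of $\mathscr L_N$ of modulus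 at least $1/r$, counted with algebraic multiplicity, is finite and at most $C_0\,r\,N$. -/

import Mathlib

open MeasureTheory Set

noncomputable section

/-- `Ω` has a boundary of class `C²`: near each boundary point it is the sublevel set `{ρ < 0}`
of a `C²` real function `ρ` (in two real variables) whose differential does not vanish there. -/
def HasC2Boundary (Ω : Set ℂ) : Prop :=
  ∀ p ∈ frontier Ω, ∃ V : Set ℂ, IsOpen V ∧ p ∈ V ∧ ∃ ρ : ℂ → ℝ,
    ContDiffOn ℝ 2 ρ V ∧ fderiv ℝ ρ p ≠ 0 ∧ Ω ∩ V = {z | z ∈ V ∧ ρ z < 0}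

/-- The restriction of `f` to `Ω` extends to a continuous function on the closure of `Ω`. -/
def ExtendsContinuously (f : ℂ → ℂ) (Ω : Set ℂ) : Prop :=
  ∃ g : ℂ → ℂ, ContinuousOn g (closure Ω) ∧ EqOn g f Ω

/-- The standing assumptions on the domain `Ω`, the holomorphic maps `γ₁, …, γ_d : Ω → Ω` and the
weight `G : Ω → ℂ`.  Only the values of `γ j` and `G` on `Ω` matter. -/
structure IsAdmissible {d : ℕ} (Ω : Set ℂ) (γ : Fin d → ℂ → ℂ) (G : ℂ → ℂ) : Prop where
  isOpen : IsOpen Ω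
  isBounded : Bornology.IsBounded Ω
  isSimplyConnected : IsSimplyConnected Ω
  c2Boundary : HasC2Boundary Ω
  map_differentiableOn : ∀ j, DifferentiableOn ℂ (γ j) Ω
  map_extends : ∀ j, ExtendsContinuously (γ j) Ω
  closure_image_subset : ∀ j, closure (γ j '' Ω) ⊆ Ω
  weight_differentiableOn : DifferentiableOn ℂ G Ω
  weight_extends : ExtendsContinuously G Ω

/-- The Bergman space `H²(Ω, ℂᴺ)` of holomorphic functions `F : Ω → ℂᴺ` that are square integrable
for Lebesgue measure, where `ℂᴺ` carries its Hermitian norm.  A function on `Ω` is represented by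
its extension by zero to the whole plane. -/
def bergmanSpace (Ω : Set ℂ) (N : ℕ) : Submodule ℂ (ℂ → EuclideanSpace ℂ (Fin N)) where
  carrier := {F | DifferentiableOn ℂ F Ω ∧ MemLp F 2 (volume.restrict Ω) ∧ ∀ z ∉ Ω, F z = 0}
  add_mem' := by
    rintro F H ⟨h1, h2, h3⟩ ⟨k1, k2, k3⟩
    exact ⟨h1.add k1, h2.add k2, fun z hz => by simp [h3 z hz, k3 z hz]⟩
  zero_mem' := ⟨differentiableOn_const 0, MemLp.zero, fun _ _ => rfl⟩
  smul_mem' := by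
    rintro c F ⟨h1, h2, h3⟩
    exact ⟨h1.const_smul c, h2.const_smul c, fun z hz => by simp [h3 z hz]⟩

/-- The permutation matrix of `σ`, acting on `ℂᴺ`. -/
def permAction {N : ℕ} (σ : Equiv.Perm (Fin N)) :
    EuclideanSpace ℂ (Fin N) →ₗ[ℂ] EuclideanSpace ℂ (Fin N) :=
  Matrix.toEuclideanLin (σ.permMatrix ℂ)

/-- The expression `∑ⱼ e^{G(γⱼ z)} Uⱼ F(γⱼ z)` for `z ∈ Ω` (and zero outside `Ω`), where `Uⱼ` is
the permutation matrix of `σⱼ`. -/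
def transferFun {d N : ℕ} (Ω : Set ℂ) (γ : Fin d → ℂ → ℂ) (G : ℂ → ℂ)
    (σ : Fin d → Equiv.Perm (Fin N)) (F : ℂ → EuclideanSpace ℂ (Fin N)) :
    ℂ → EuclideanSpace ℂ (Fin N) :=
  Ω.indicator fun z => ∑ j, Complex.exp (G (γ j z)) • permAction (σ j) (F (γ j z))

theorem IsAdmissible.mapsTo {d : ℕ} {Ω : Set ℂ} {γ : Fin d → ℂ → ℂ} {G : ℂ → ℂ}
    (h : IsAdmissible Ω γ G) (j : Fin d) : MapsTo (γ j) Ω Ω := fun _ hz =>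
  h.closure_image_subset j (subset_closure (mem_image_of_mem _ hz))

theorem transferFun_mem {d N : ℕ} {Ω : Set ℂ} {γ : Fin d → ℂ → ℂ} {G : ℂ → ℂ}
    (h : IsAdmissible Ω γ G) (σ : Fin d → Equiv.Perm (Fin N))
    {F : ℂ → EuclideanSpace ℂ (Fin N)} (hF : F ∈ bergmanSpace Ω N) :
    transferFun Ω γ G σ F ∈ bergmanSpace Ω N := by
  obtain ⟨hd, -, -⟩ := hF
  have hq : ∀ j, DifferentiableOn ℂ
      (fun w => Complex.exp (G w) • permAction (σ j) (F w)) Ω := fun j =>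
    h.weight_differentiableOn.cexp.smul
      ((permAction (σ j)).toContinuousLinearMap.differentiable.comp_differentiableOn hd)
  have hs : DifferentiableOn ℂ
      (fun z => ∑ j, Complex.exp (G (γ j z)) • permAction (σ j) (F (γ j z))) Ω :=
    DifferentiableOn.fun_sum fun j _ =>
      (hq j).comp (h.map_differentiableOn j) (h.mapsTo j)
  refine ⟨hs.congr fun z hz => indicator_of_mem hz _, ?_, fun z hz => indicator_of_notMem hz _⟩
  have hfin : volume Ω < ⊤ := h.isBounded.measure_lt_top
  have : IsFiniteMeasure (volume.restrict Ω) := ⟨by simpa using hfin⟩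
  have hB : ∀ j, ∃ C : ℝ, ∀ z ∈ Ω,
      ‖Complex.exp (G (γ j z)) • permAction (σ j) (F (γ j z))‖ ≤ C := by
    intro j
    have hK : IsCompact (closure (γ j '' Ω)) :=
      (h.isBounded.subset (h.mapsTo j).image_subset).isCompact_closure
    obtain ⟨C, hC⟩ := hK.exists_bound_of_continuousOn
      ((hq j).continuousOn.mono (h.closure_image_subset j))
    exact ⟨C, fun z hz => hC _ (subset_closure (mem_image_of_mem _ hz))⟩
  choose C hC using hB
  have hm : MemLp (fun z => ∑ j, Complex.exp (G (γ j z)) • permAction (σ j) (F (γ j z))) 2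
      (volume.restrict Ω) := by
    refine MemLp.of_bound (hs.continuousOn.aestronglyMeasurable h.isOpen.measurableSet)
      (∑ j, C j) ?_
    filter_upwards [ae_restrict_mem h.isOpen.measurableSet] with z hz
    exact (norm_sum_le _ _).trans (Finset.sum_le_sum fun j _ => hC j z hz)
  exact hm.indicator h.isOpen.measurableSet

/-- The twisted transfer operator `F ↦ ∑ⱼ e^{G ∘ γⱼ} Uⱼ (F ∘ γⱼ)` on `H²(Ω, ℂᴺ)`. -/
def transferOperator {d N : ℕ} {Ω : Set ℂ} {γ : Fin d → ℂ → ℂ} {G : ℂ → ℂ}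
    (h : IsAdmissible Ω γ G) (σ : Fin d → Equiv.Perm (Fin N)) :
    Module.End ℂ (bergmanSpace Ω N) where
  toFun F := ⟨transferFun Ω γ G σ F, transferFun_mem h σ F.2⟩
  map_add' F H := by
    ext1
    funext z
    by_cases hz : z ∈ Ω <;> simp [transferFun, hz, Finset.sum_add_distrib]
  map_smul' c F := by
    ext1
    funext z
    by_cases hz : z ∈ Ω <;> simp [transferFun, hz, Finset.smul_sum, smul_comm c]

/-- The algebraic multiplicity of `μ` as an eigenvalue of `T`: the dimension (possibly `⊤`) of the
generalized eigenspace `⋃ₖ ker (T - μ)ᵏ`.  It is zero when `μ` is not an eigenvalue. -/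
def algMultiplicity {V : Type*} [AddCommGroup V] [Module ℂ V] (T : Module.End ℂ V) (μ : ℂ) : ℕ∞ :=
  Cardinal.toENat (Module.rank ℂ (T.maxGenEigenspace μ))

/-- The number (possibly `⊤`) of eigenvalues `μ` of `T` with `‖μ‖ ≥ ρ`, counted with algebraic
multiplicity: the supremum of the finite partial sums of the multiplicities. -/
def eigenvalueCount {V : Type*} [AddCommGroup V] [Module ℂ V] (T : Module.End ℂ V) (ρ : ℝ) : ℕ∞ :=
  ⨆ s : Finset {μ : ℂ // T.HasEigenvalue μ ∧ ρ ≤ ‖μ‖}, ∑ μ ∈ s, algMultiplicity T μ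

end

/-! The operator is of trace class on the Bergman space, with trace norm `O(N)`, and eigenvalues are
controlled by diagonal entries. Let `W` be a finite-dimensional invariant subspace on which all
eigenvalues have modulus at least `1/r`. Schur triangularisation gives an orthonormal basis `e` of
`W` whose diagonal entries have modulus at least `1/r`, so `dim W / r` is at most the sum of the
moduli of the diagonal entries. A bound `C * N` for that sum over every finite orthonormal family
bounds `dim W`, and `eigenvalueCount_le` turns this into a bound on the count, finiteness included.

The bound on the diagonal (`sum_norm_integral_inner_weightedComposition_le`) comes from the distance
between the images of the `γ j` and the complement of `Ω`. By the mean value property, `F (γ j z)`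
is the average of `F` over a disc of fixed radius `δ` inside `Ω`, so composition becomes an integral
operator with bounded kernel. After Fubini, Cauchy–Schwarz and Bessel's inequality bound the sum
independently of the size of the family. Splitting along the `d` maps and the `N` coordinates costs
a factor `d * N`. -/

/-! ### Schur triangularisation and eigenvalue counting. -/

/-- An endomorphism of a finite-dimensional inner product space all of whose eigenvalues have
modulus at least `c` has diagonal entries of modulus at least `c` in some orthonormal basis. -/
theorem exists_orthonormal_le_norm_inner (n : ℕ) {V : Type*} [NormedAddCommGroup V]
    [InnerProductSpace ℂ V] [FiniteDimensional ℂ V] (hn : Module.finrank ℂ V = n)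
    (T : V →ₗ[ℂ] V) (c : ℝ) (hT : ∀ (μ : ℂ) (v : V), v ≠ 0 → T v = μ • v → c ≤ ‖μ‖) :
    ∃ e : Fin n → V, Orthonormal ℂ e ∧ ∀ i, c ≤ ‖inner ℂ (e i) (T (e i))‖ := by
  induction n generalizing V with
  | zero => exact ⟨Fin.elim0, ⟨fun i => i.elim0, fun i => i.elim0⟩, fun i => i.elim0⟩
  | succ n ih =>
    have : Nontrivial V := Module.nontrivial_of_finrank_pos (R := ℂ) (by omega)
    -- The orthogonal complement of an eigenvector of the adjoint is `T`-invariant, which drives the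
    -- induction.
    obtain ⟨ν, hν⟩ := Module.End.exists_eigenvalue (LinearMap.adjoint T)
    obtain ⟨v, hv, hv0⟩ := hν.exists_hasEigenvector
    rw [Module.End.mem_eigenspace_iff] at hv
    have hvT : ∀ x, inner ℂ v (T x) = (starRingEnd ℂ) ν * inner ℂ v x := fun x => by
      rw [← LinearMap.adjoint_inner_left, hv, inner_smul_left]
    -- The conjugate of `ν` is an eigenvalue of `T`: otherwise `T - conj ν` would be surjective, yet
    -- its range is orthogonal to `v`.
    have hc : c ≤ ‖ν‖ := by
      by_contra hlt
      have hinj : Function.Injective (T - (starRingEnd ℂ) ν • LinearMap.id : V →ₗ[ℂ] V) := by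
        rw [← LinearMap.ker_eq_bot, LinearMap.ker_eq_bot']
        intro x hx
        by_contra hx0
        refine hlt ?_
        rw [← RCLike.norm_conj ν]
        exact hT _ x hx0 (by simpa [sub_eq_zero] using hx)
      obtain ⟨x, hx⟩ := LinearMap.injective_iff_surjective.1 hinj v
      have h0 : inner ℂ v v = (0 : ℂ) := by
        nth_rewrite 2 [← hx]
        simp [hvT]
      exact hv0 (inner_self_eq_zero.1 h0)
    set u : V := ((‖v‖ : ℂ)⁻¹) • v with hu
    have hu1 : ‖u‖ = 1 := by
      have : ‖v‖ ≠ 0 := norm_ne_zero_iff.2 hv0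
      simp [hu, norm_smul, this]
    have huT : ∀ x, inner ℂ u (T x) = (starRingEnd ℂ) ν * inner ℂ u x := fun x => by
      simp only [hu, inner_smul_left, hvT]; ring
    set K : Submodule ℂ V := (Submodule.span ℂ {u})ᗮ with hK
    have hmem : ∀ x, x ∈ K ↔ inner ℂ u x = (0 : ℂ) := fun x =>
      Submodule.mem_orthogonal_singleton_iff_inner_right
    have hKT : ∀ x ∈ K, T x ∈ K := fun x hx => by
      rw [hmem] at hx ⊢
      rw [huT, hx, mul_zero]
    have hu0 : u ≠ 0 := fun h => by simp [h] at hu1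
    have hKn : Module.finrank ℂ K = n := by
      have h1 := Submodule.finrank_add_finrank_orthogonal (Submodule.span ℂ {u})
      rw [finrank_span_singleton hu0, hn] at h1
      rw [hK]
      omega
    obtain ⟨e, he, hec⟩ := ih hKn (T.restrict hKT) fun μ w hw hwT =>
      hT μ w (by simpa using hw) (by simpa using congrArg Subtype.val hwT)
    refine ⟨Fin.cons u fun i => (e i : V), ?_, Fin.cases ?_ fun i => ?_⟩
    · have := he.comp_linearIsometry K.subtypeₗᵢ
      refine orthonormal_vecCons_iff.2 ⟨hu1, fun i => (hmem _).1 (e i).2, this⟩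
    · rw [Fin.cons_zero, huT]
      simpa [inner_self_eq_norm_sq_to_K, hu1] using hc
    · simpa using hec i

/-- The version of `exists_orthonormal_le_norm_inner` for an invariant subspace of a space that
embeds into an inner product space. -/
theorem exists_orthonormal_le_norm_inner_of_invariant {X H : Type*} [AddCommGroup X] [Module ℂ X]
    [NormedAddCommGroup H] [InnerProductSpace ℂ H] (J : X →ₗ[ℂ] H) (hJ : Function.Injective J)
    (T : Module.End ℂ X) (W : Submodule ℂ X) [FiniteDimensional ℂ W] (hW : ∀ x ∈ W, T x ∈ W)
    (c : ℝ) (hT : ∀ (μ : ℂ), ∀ v ∈ W, v ≠ 0 → T v = μ • v → c ≤ ‖μ‖) :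
    ∃ e : Fin (Module.finrank ℂ W) → X, Orthonormal ℂ (fun i => J (e i)) ∧
      ∀ i, c ≤ ‖inner ℂ (J (e i)) (J (T (e i)))‖ := by
  set E := Submodule.equivMapOfInjective J hJ W
  have hE : ∀ x, ((E x : W.map J) : H) = J x := fun x => rfl
  have hfd : FiniteDimensional ℂ (W.map J) := E.finiteDimensional
  obtain ⟨e, he, hec⟩ := exists_orthonormal_le_norm_inner (Module.finrank ℂ W)
    E.finrank_eq.symm (E.conj (T.restrict hW)) c fun μ v hv hvT => by
      refine hT μ (E.symm v) (E.symm v).2 (by simpa using hv) ?_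
      have h1 : T.restrict hW (E.symm v) = μ • E.symm v := by
        rw [← map_smul, ← hvT]
        simp [LinearEquiv.conj_apply]
      simpa using congrArg Subtype.val h1
  refine ⟨fun i => E.symm (e i), ?_, fun i => ?_⟩
  · have h1 := he.comp_linearIsometry (W.map J).subtypeₗᵢ
    convert h1 using 2 with i
    simp [← hE]
  · convert hec i using 2
    rw [Submodule.coe_inner]
    congr 1
    · simp [← hE]

/-- Every finite subset of a maximal generalized eigenspace lies in a finite-dimensional invariant
subspace of it. -/
theorem exists_invariant_finiteDimensional {X : Type*} [AddCommGroup X] [Module ℂ X]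
    (T : Module.End ℂ X) (μ : ℂ) (s : Finset X) (hs : ∀ v ∈ s, v ∈ T.maxGenEigenspace μ) :
    ∃ W : Submodule ℂ X, FiniteDimensional ℂ W ∧ W ≤ T.maxGenEigenspace μ ∧ (∀ v ∈ s, v ∈ W) ∧
      ∀ x ∈ W, T x ∈ W := by
  classical
  set S : Module.End ℂ X := T - μ • 1 with hS
  have hk : ∀ v : X, ∃ k : ℕ, v ∈ s → (S ^ k) v = 0 := fun v => by
    by_cases hv : v ∈ s
    · obtain ⟨k, hk⟩ := (Module.End.mem_maxGenEigenspace T μ v).1 (hs v hv)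
      exact ⟨k, fun _ => hk⟩
    · exact ⟨0, fun h => absurd h hv⟩
  choose k hk using hk
  have hST : ∀ x ∈ T.maxGenEigenspace μ, S x ∈ T.maxGenEigenspace μ := fun x hx => by
    obtain ⟨m, hm⟩ := (Module.End.mem_maxGenEigenspace T μ x).1 hx
    refine (Module.End.mem_maxGenEigenspace T μ _).2 ⟨m, ?_⟩
    change (S ^ m) (S x) = 0
    rw [← Module.End.mul_apply, ← pow_succ, pow_succ', Module.End.mul_apply, hm, map_zero]
  -- The chains `v, S v, …, S ^ (k v - 1) v` are finite, and `S` shifts each along itself until it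
  -- reaches zero.
  set A : Finset X := s.biUnion fun v => (Finset.range (k v)).image fun i => (S ^ i) v with hA
  have hAS : ∀ x ∈ Submodule.span ℂ (A : Set X), S x ∈ Submodule.span ℂ (A : Set X) := by
    intro x hx
    have : Submodule.span ℂ (A : Set X) ≤ (Submodule.span ℂ (A : Set X)).comap S := by
      rw [Submodule.span_le]
      intro y hy
      simp only [hA, Finset.coe_biUnion, mem_iUnion, Finset.mem_coe, Finset.mem_image,
        Finset.mem_range, exists_prop] at hy
      obtain ⟨v, hv, i, hi, rfl⟩ := hy
      change S ((S ^ i) v) ∈ Submodule.span ℂ (A : Set X)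
      rw [← Module.End.mul_apply, ← pow_succ']
      rcases Nat.lt_or_ge (i + 1) (k v) with h | h
      · exact Submodule.subset_span (Finset.mem_coe.2 (Finset.mem_biUnion.2
          ⟨v, hv, Finset.mem_image.2 ⟨i + 1, Finset.mem_range.2 h, rfl⟩⟩))
      · have : i + 1 = k v := by omega
        rw [this, hk v hv]
        exact zero_mem _
    exact this hx
  refine ⟨Submodule.span ℂ (A : Set X), FiniteDimensional.span_finset ℂ A, ?_, fun v hv => ?_,
    fun x hx => ?_⟩
  · rw [Submodule.span_le]
    intro y hy
    simp only [hA, Finset.coe_biUnion, mem_iUnion, Finset.mem_coe, Finset.mem_image,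
      Finset.mem_range, exists_prop] at hy
    obtain ⟨v, hv, i, -, rfl⟩ := hy
    induction i with
    | zero => simpa using hs v hv
    | succ i ih =>
      rw [pow_succ', Module.End.mul_apply]
      exact hST _ ih
  -- An empty chain, `k v = 0`, forces `v = 0`.
  · rcases Nat.eq_zero_or_pos (k v) with h | h
    · have := hk v hv
      rw [h, pow_zero, Module.End.one_apply] at this
      rw [this]
      exact zero_mem _
    · exact Submodule.subset_span (Finset.mem_coe.2 (Finset.mem_biUnion.2
        ⟨v, hv, Finset.mem_image.2 ⟨0, Finset.mem_range.2 h, by simp⟩⟩))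
  · have h1 : T x = S x + μ • x := by simp [hS]
    rw [h1]
    exact add_mem (hAS x hx) (Submodule.smul_mem _ _ hx)

/-- A dimension bound for the finite-dimensional invariant subspaces on which all eigenvalues have
modulus at least `c` bounds the number of eigenvalues of modulus at least `c`. -/
theorem eigenvalueCount_le {X : Type*} [AddCommGroup X] [Module ℂ X] (T : Module.End ℂ X)
    (c : ℝ) (B : ℕ)
    (hB : ∀ W : Submodule ℂ X, FiniteDimensional ℂ W → (∀ x ∈ W, T x ∈ W) →
      (∀ (μ : ℂ), ∀ v ∈ W, v ≠ 0 → T v = μ • v → c ≤ ‖μ‖) → Module.finrank ℂ W ≤ B) :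
    eigenvalueCount T c ≤ B := by
  classical
  have hind := Module.End.independent_maxGenEigenspace T
  -- By independence, an invariant subspace inside a sum of generalized eigenspaces has no
  -- eigenvalues beyond the ones summed over; this supplies the eigenvalue hypothesis of `hB`.
  have hdisj : ∀ (s : Finset ℂ) (ν : ℂ) (v : X), v ≠ 0 → T v = ν • v →
      v ∈ ⨆ μ ∈ s, T.maxGenEigenspace μ → ν ∈ s := by
    intro s ν v hv hTv hvs
    by_contra hν
    have h1 : v ∈ T.maxGenEigenspace ν :=
      (Module.End.mem_maxGenEigenspace T ν v).2 ⟨1, by simp [hTv]⟩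
    have h2 : Disjoint (T.maxGenEigenspace ν) (⨆ μ ∈ s, T.maxGenEigenspace μ) :=
      hind.disjoint_biSup (y := (s : Set ℂ)) hν
    exact hv ((Submodule.disjoint_def.1 h2) v h1 hvs)
  have hfin : ∀ μ : ℂ, c ≤ ‖μ‖ → FiniteDimensional ℂ (T.maxGenEigenspace μ) := by
    intro μ hμ
    -- Finite dimension is not known in advance: each finite independent set is enclosed in a
    -- finite-dimensional invariant subspace, so it has at most `B` elements.
    refine Module.rank_lt_aleph0_iff.1 (lt_of_le_of_lt (rank_le (n := B) fun s hs => ?_)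
      (Cardinal.natCast_lt_aleph0))
    obtain ⟨W, hWf, hWle, hsW, hWT⟩ := exists_invariant_finiteDimensional T μ
      (s.image Subtype.val) (by simp +contextual)
    have hle := hB W hWf hWT fun ν v hv hv0 hTv => by
      have := hdisj {μ} ν v hv0 hTv (by simpa using hWle hv)
      rw [Finset.mem_singleton.1 this]
      exact hμ
    refine le_trans ?_ hle
    have hli : LinearIndependent ℂ (fun x : s => (⟨((x : T.maxGenEigenspace μ) : X),
        hsW _ (Finset.mem_image_of_mem _ x.2)⟩ : W)) := by
      refine LinearIndependent.of_comp W.subtype ?_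
      exact hs.map' (T.maxGenEigenspace μ).subtype (Submodule.ker_subtype _)
    simpa using hli.fintype_card_le_finrank
  refine iSup_le fun s => ?_
  set W : {μ : ℂ // T.HasEigenvalue μ ∧ c ≤ ‖μ‖} → Submodule ℂ X :=
    fun μ => T.maxGenEigenspace μ with hWdef
  have hWfin : ∀ μ, FiniteDimensional ℂ (W μ) := fun μ => hfin μ μ.2.2
  have hWind : iSupIndep fun μ : s => W μ :=
    hind.comp (f := fun μ : s => ((μ : {μ : ℂ // T.HasEigenvalue μ ∧ c ≤ ‖μ‖}) : ℂ))
      (Subtype.val_injective.comp Subtype.val_injective)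
  set V : Submodule ℂ X := ⨆ μ : s, W μ with hV
  have hVfin : FiniteDimensional ℂ V := Submodule.finiteDimensional_iSup _
  have hVle : V ≤ ⨆ μ ∈ s.image Subtype.val, T.maxGenEigenspace μ := by
    refine iSup_le fun μ => ?_
    exact le_iSup₂_of_le (μ : ℂ) (Finset.mem_image_of_mem _ μ.2) le_rfl
  have hVB : Module.finrank ℂ V ≤ B := by
    refine hB V hVfin (fun x hx => ?_) fun ν v hv hv0 hTv => ?_
    · have : V ≤ V.comap T := by
        refine iSup_le fun μ x hx => ?_
        exact (le_iSup (fun μ : s => W μ) μ)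
          (Module.End.mapsTo_maxGenEigenspace_of_comm (Commute.refl T) _ hx)
      exact this hx
    · have := hdisj _ ν v hv0 hTv (hVle hv)
      obtain ⟨μ, -, rfl⟩ := Finset.mem_image.1 this
      exact μ.2.2
  have hsum : ∑ μ : s, Module.finrank ℂ (W μ) = Module.finrank ℂ V := by
    rw [hV, Submodule.iSup_eq_range_dfinsupp_lsum,
      LinearMap.finrank_range_of_inj hWind.dfinsupp_lsum_injective]
    exact (Module.finrank_directSum ℂ fun μ : s => W μ).symm
  have hterm : ∀ μ ∈ s, algMultiplicity T μ = (Module.finrank ℂ (W μ) : ℕ∞) := fun μ _ => by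
    have := hWfin μ
    rw [algMultiplicity]
    change Cardinal.toENat (Module.rank ℂ (W μ)) = _
    rw [← Module.finrank_eq_rank, Cardinal.toENat_nat]
  rw [Finset.sum_congr rfl hterm, ← Nat.cast_sum, ← Finset.sum_coe_sort s, hsum]
  exact_mod_cast hVB

/-! ### Mean value property and point evaluations in the Bergman space. -/

/-- The mean value property over discs. -/
theorem setIntegral_ball_eq_of_differentiableOn {f : ℂ → ℂ} {w : ℂ} {δ : ℝ}
    (hf : DifferentiableOn ℂ f (Metric.closedBall w δ)) (hδ : 0 < δ) :
    ∫ ζ in Metric.ball w δ, f ζ = (Real.pi * δ ^ 2 : ℝ) * f w := by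
  have hmem : ∀ r θ : ℝ, 0 ≤ r → r ≤ δ → w + Complex.polarCoord.symm (r, θ) ∈ Metric.closedBall w δ := by
    intro r θ h0 h1
    rw [Metric.mem_closedBall, dist_eq_norm, add_sub_cancel_left, Complex.norm_polarCoord_symm,
      abs_of_nonneg h0]
    exact h1
  set F : ℝ × ℝ → ℂ := fun p => p.1 • f (w + Complex.polarCoord.symm p) with hF
  have h1 : ∫ ζ in Metric.ball w δ, f ζ
      = ∫ ζ, (Metric.ball (0 : ℂ) δ).indicator (fun ζ => f (w + ζ)) ζ := by
    rw [← integral_indicator measurableSet_ball,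
      ← integral_add_left_eq_self _ w]
    refine integral_congr_ae (Filter.Eventually.of_forall fun ζ => ?_)
    simp only [indicator, Metric.mem_ball, dist_eq_norm, add_sub_cancel_left, sub_zero]
  have h2 : ∫ ζ in Metric.ball w δ, f ζ
      = ∫ p in Ioo (0 : ℝ) δ ×ˢ Ioo (-Real.pi) Real.pi, F p := by
    rw [h1, ← Complex.integral_comp_polarCoord_symm, polarCoord_target]
    have hsub : Ioo (0 : ℝ) δ ×ˢ Ioo (-Real.pi) Real.pi ⊆ Ioi (0 : ℝ) ×ˢ Ioo (-Real.pi) Real.pi :=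
      prod_mono Ioo_subset_Ioi_self le_rfl
    refine (setIntegral_eq_of_subset_of_forall_sdiff_eq_zero
      (measurableSet_Ioi.prod measurableSet_Ioo) hsub ?_).trans ?_
    rotate_left
    · refine setIntegral_congr_fun (measurableSet_Ioo.prod measurableSet_Ioo) fun p hp => ?_
      have : Complex.polarCoord.symm p ∈ Metric.ball (0 : ℂ) δ := by
        rw [mem_ball_zero_iff, Complex.norm_polarCoord_symm, abs_of_pos hp.1.1]
        exact hp.1.2
      simp only [indicator_of_mem this, hF]
    · rintro p ⟨hp, hp'⟩
      have : Complex.polarCoord.symm p ∉ Metric.ball (0 : ℂ) δ := by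
        rw [mem_ball_zero_iff, Complex.norm_polarCoord_symm, abs_of_pos hp.1]
        exact fun h => hp' ⟨⟨hp.1, h⟩, hp.2⟩
      simp only [indicator_of_notMem this, smul_zero]
  have hpc : Continuous fun p : ℝ × ℝ => Complex.polarCoord.symm p := by
    simp only [Complex.polarCoord_symm_apply]
    fun_prop
  have hint : IntegrableOn F (Ioo (0 : ℝ) δ ×ˢ Ioo (-Real.pi) Real.pi) := by
    have hc : ContinuousOn F (Icc (0 : ℝ) δ ×ˢ Icc (-Real.pi) Real.pi) := by
      refine continuousOn_fst.smul (hf.continuousOn.comp (by fun_prop) fun p hp => ?_)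
      exact hmem p.1 p.2 hp.1.1 hp.1.2
    exact (hc.integrableOn_compact (isCompact_Icc.prod isCompact_Icc)).mono_set
      (prod_mono Ioo_subset_Icc_self Ioo_subset_Icc_self)
  have h3 : ∀ r ∈ Ioo (0 : ℝ) δ,
      ∫ θ in Ioo (-Real.pi) Real.pi, F (r, θ) = r • ((2 * Real.pi) • f w) := by
    intro r hr
    have hd : DiffContOnCl ℂ f (Metric.ball w |r|) := by
      refine (hf.mono (Metric.closedBall_subset_closedBall ?_)).diffContOnCl_ball
        le_rfl
      rw [abs_of_pos hr.1]
      exact hr.2.le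
    have hav := hd.circleAverage
    -- Shifting the angle by `-π` matches the range `(-π, π)` of polar coordinates.
    rw [Real.circleAverage_eq_integral_add (-Real.pi)] at hav
    rw [← hav, smul_smul (2 * Real.pi), mul_inv_cancel₀ (by positivity), one_smul]
    simp only [hF, integral_smul]
    congr 1
    rw [intervalIntegral.integral_comp_add_right (fun θ => f (circleMap w r θ)),
      ← integral_Ioc_eq_integral_Ioo, zero_add, show 2 * Real.pi + -Real.pi = Real.pi by ring,
      intervalIntegral.integral_of_le (by linarith [Real.pi_pos])]
    refine setIntegral_congr_fun measurableSet_Ioc fun θ _ => ?_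
    simp only [circleMap, Complex.polarCoord_symm_apply, Complex.exp_mul_I, Complex.ofReal_cos,
      Complex.ofReal_sin]
  rw [h2, Measure.volume_eq_prod, setIntegral_prod _ hint,
    setIntegral_congr_fun measurableSet_Ioo h3, integral_smul_const,
    ← integral_Ioc_eq_integral_Ioo, ← intervalIntegral.integral_of_le hδ.le, integral_id]
  simp only [Complex.real_smul]
  push_cast
  ring

/-- The inclusion of the Bergman space in `L²`. -/
noncomputable def bergmanToLp (Ω : Set ℂ) (N : ℕ) :
    bergmanSpace Ω N →ₗ[ℂ] Lp (EuclideanSpace ℂ (Fin N)) 2 (volume.restrict Ω) where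
  toFun F := F.2.2.1.toLp F.1
  map_add' F H := MemLp.toLp_add F.2.2.1 H.2.2.1
  map_smul' c F := MemLp.toLp_const_smul c F.2.2.1

theorem bergmanToLp_ae_eq {Ω : Set ℂ} {N : ℕ} (F : bergmanSpace Ω N) :
    bergmanToLp Ω N F =ᵐ[volume.restrict Ω] F.1 :=
  F.2.2.1.coeFn_toLp

theorem bergmanToLp_injective {Ω : Set ℂ} (hΩ : IsOpen Ω) (N : ℕ) :
    Function.Injective (bergmanToLp Ω N) := by
  intro F H hFH
  have hae : F.1 =ᵐ[volume.restrict Ω] H.1 := (MemLp.toLp_eq_toLp_iff F.2.2.1 H.2.2.1).1 hFH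
  have heq : EqOn F.1 H.1 Ω := Measure.eqOn_open_of_ae_eq hae hΩ F.2.1.continuousOn
    H.2.1.continuousOn
  refine Subtype.ext (funext fun z => ?_)
  by_cases hz : z ∈ Ω
  · exact heq hz
  · rw [F.2.2.2 z hz, H.2.2.2 z hz]

theorem inner_bergmanToLp {Ω : Set ℂ} {N : ℕ} (F H : bergmanSpace Ω N) :
    inner ℂ (bergmanToLp Ω N F) (bergmanToLp Ω N H) = ∫ z in Ω, inner ℂ (F.1 z) (H.1 z) := by
  rw [L2.inner_def]
  refine integral_congr_ae ?_
  filter_upwards [bergmanToLp_ae_eq F, bergmanToLp_ae_eq H] with z h1 h2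
  rw [h1, h2]

/-- Bessel's inequality against a bounded function. -/
theorem sum_norm_sq_integral_inner_le {Ω : Set ℂ} (hΩ : volume Ω ≠ ⊤) {N n : ℕ}
    {e : Fin n → bergmanSpace Ω N} (he : Orthonormal ℂ fun m => bergmanToLp Ω N (e m))
    {ψ : ℂ → EuclideanSpace ℂ (Fin N)} (hψ : AEStronglyMeasurable ψ (volume.restrict Ω)) {M : ℝ}
    (hM : 0 ≤ M) (hψM : ∀ z, ‖ψ z‖ ≤ M) :
    ∑ m, ‖∫ z in Ω, inner ℂ ((e m).1 z) (ψ z)‖ ^ 2 ≤ M ^ 2 * volume.real Ω := by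
  have : IsFiniteMeasure (volume.restrict Ω) := ⟨by simpa using hΩ.lt_top⟩
  have hmem : MemLp ψ 2 (volume.restrict Ω) :=
    MemLp.of_bound hψ M (Filter.Eventually.of_forall hψM)
  have hin : ∀ m, ∫ z in Ω, inner ℂ ((e m).1 z) (ψ z)
      = inner ℂ (bergmanToLp Ω N (e m)) (hmem.toLp ψ) := fun m => by
    rw [L2.inner_def]
    refine integral_congr_ae ?_
    filter_upwards [bergmanToLp_ae_eq (e m), hmem.coeFn_toLp] with z h1 h2
    rw [h1, h2]
  simp only [hin]
  refine (he.sum_inner_products_le (s := Finset.univ) (x := hmem.toLp ψ)).trans ?_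
  have hnorm : ‖hmem.toLp ψ‖ ≤ (volume.restrict Ω).real univ ^ (ENNReal.toReal 2)⁻¹ * M := by
    refine Lp.norm_le_of_ae_bound hM ?_
    filter_upwards [hmem.coeFn_toLp] with z h1
    rw [h1]
    exact hψM z
  refine (pow_le_pow_left₀ (norm_nonneg _) hnorm 2).trans (le_of_eq ?_)
  rw [mul_pow, ← Real.rpow_natCast, ← Real.rpow_mul measureReal_nonneg]
  simp [mul_comm]

theorem differentiableOn_coord {Ω : Set ℂ} {N : ℕ} (F : bergmanSpace Ω N) (l : Fin N) :
    DifferentiableOn ℂ (fun z => F.1 z l) Ω :=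
  (EuclideanSpace.proj (𝕜 := ℂ) l).differentiable.comp_differentiableOn F.2.1

theorem integrableOn_bergman {Ω : Set ℂ} (hΩ : volume Ω ≠ ⊤) {N : ℕ} (F : bergmanSpace Ω N) :
    IntegrableOn F.1 Ω := by
  have : IsFiniteMeasure (volume.restrict Ω) := ⟨by simpa using hΩ.lt_top⟩
  exact F.2.2.1.integrable one_le_two

/-- The coordinates of an orthonormal family are square summable at each interior point. -/
theorem sum_norm_sq_coord_le {Ω : Set ℂ} (hΩ : volume Ω ≠ ⊤) {N n : ℕ}
    {e : Fin n → bergmanSpace Ω N} (he : Orthonormal ℂ fun m => bergmanToLp Ω N (e m)) {ζ : ℂ}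
    {δ : ℝ} (hδ : 0 < δ) (hζ : Metric.closedBall ζ δ ⊆ Ω) (l : Fin N) :
    ∑ m, ‖(e m).1 ζ l‖ ^ 2 ≤ volume.real Ω / (Real.pi * δ ^ 2) ^ 2 := by
  -- Pairing with this test function gives, up to conjugation, the disc area times the coordinate at
  -- `ζ`, so Bessel's inequality applies.
  set ψ : ℂ → EuclideanSpace ℂ (Fin N) :=
    (Metric.ball ζ δ).indicator fun _ => EuclideanSpace.single l 1 with hψ
  have hb := sum_norm_sq_integral_inner_le hΩ he (ψ := ψ)
    (aestronglyMeasurable_const.indicator measurableSet_ball) zero_le_one fun z => by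
      refine (norm_indicator_le_norm_self _ _).trans (by simp)
  have hval : ∀ m, ‖∫ z in Ω, inner ℂ ((e m).1 z) (ψ z)‖ = Real.pi * δ ^ 2 * ‖(e m).1 ζ l‖ := by
    intro m
    have h1 : ∀ z, inner ℂ ((e m).1 z) (ψ z)
        = (Metric.ball ζ δ).indicator (fun z => (starRingEnd ℂ) ((e m).1 z l)) z := fun z => by
      by_cases hz : z ∈ Metric.ball ζ δ <;> simp [hψ, hz, EuclideanSpace.inner_single_right]
    simp only [h1]
    rw [setIntegral_indicator measurableSet_ball,
      inter_eq_self_of_subset_right (Metric.ball_subset_closedBall.trans hζ), integral_conj,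
      RCLike.norm_conj,
      setIntegral_ball_eq_of_differentiableOn ((differentiableOn_coord (e m) l).mono hζ) hδ,
      norm_mul, Complex.norm_real, Real.norm_of_nonneg (by positivity)]
  simp only [hval, mul_pow, ← Finset.mul_sum, one_pow, one_mul] at hb
  rw [le_div_iff₀ (by positivity), mul_comm, mul_pow]
  exact hb

/-! ### Trace-norm bound for weighted composition operators. -/

/-- The truncated weight that turns a weighted composition operator into an integral operator. -/
noncomputable def discKernel (δ : ℝ) (φ g : ℂ → ℂ) (z ζ : ℂ) : ℂ :=
  if ‖ζ - φ z‖ < δ then g z else 0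

theorem measurable_discKernel (δ : ℝ) {φ g : ℂ → ℂ} (hφ : Measurable φ) (hg : Measurable g) :
    Measurable fun p : ℂ × ℂ => discKernel δ φ g p.1 p.2 :=
  Measurable.ite (measurableSet_lt (by fun_prop) measurable_const) (by fun_prop) measurable_const

theorem norm_discKernel_le {δ M : ℝ} {φ g : ℂ → ℂ} (hg : ∀ z, ‖g z‖ ≤ M) (z ζ : ℂ) :
    ‖discKernel δ φ g z ζ‖ ≤ M := by
  rw [discKernel]
  split_ifs
  · exact hg z
  · simpa using (norm_nonneg _).trans (hg z)

section WeightedComposition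

variable {Ω S : Set ℂ} {N : ℕ} {δ M : ℝ} {φ g : ℂ → ℂ}

/-- Justifies Fubini: the integrand is a tensor product of two integrable functions times a bounded
measurable kernel. -/
theorem integrable_discKernel (hΩ : volume Ω ≠ ⊤) (hSΩ : S ⊆ Ω)
    (hφ : Measurable φ) (hg : Measurable g) (hgM : ∀ z, ‖g z‖ ≤ M) (F : bergmanSpace Ω N)
    (l : Fin N) (u : EuclideanSpace ℂ (Fin N)) :
    Integrable (fun p : ℂ × ℂ => F.1 p.2 l * inner ℂ (F.1 p.1) (discKernel δ φ g p.1 p.2 • u))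
      ((volume.restrict Ω).prod (volume.restrict S)) := by
  have hF := integrableOn_bergman hΩ F
  have ha : Integrable (fun z => inner ℂ (F.1 z) u) (volume.restrict Ω) := hF.inner_const u
  have hb : Integrable (fun ζ => F.1 ζ l) (volume.restrict S) :=
    (EuclideanSpace.proj (𝕜 := ℂ) l).integrable_comp (hF.mono_set hSΩ)
  have := (ha.mul_prod hb).bdd_mul (c := M)
    (measurable_discKernel δ hφ hg).aestronglyMeasurable
    (Filter.Eventually.of_forall fun p => norm_discKernel_le hgM p.1 p.2)
  refine this.congr (Filter.Eventually.of_forall fun p => ?_)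
  simp only [inner_smul_right]
  ring

/-- The mean value property on the disc of radius `δ` about `φ z`. The cutoff sits in the kernel, so
the domain `S` of integration does not depend on `z`. -/
theorem weightedComposition_eq (hδ : 0 < δ)
    (hball : ∀ z ∈ Ω, Metric.ball (φ z) δ ⊆ S) (hcl : ∀ ζ ∈ S, Metric.closedBall ζ δ ⊆ Ω)
    (F : bergmanSpace Ω N) (l : Fin N) (u : EuclideanSpace ℂ (Fin N)) {z : ℂ} (hz : z ∈ Ω) :
    inner ℂ (F.1 z) ((g z * F.1 (φ z) l) • u) = ((Real.pi * δ ^ 2 : ℝ) : ℂ)⁻¹ *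
      ∫ ζ in S, F.1 ζ l * inner ℂ (F.1 z) (discKernel δ φ g z ζ • u) := by
  have hφS : φ z ∈ S := hball z hz (Metric.mem_ball_self hδ)
  have h1 : ∀ ζ, F.1 ζ l * inner ℂ (F.1 z) (discKernel δ φ g z ζ • u) =
      (Metric.ball (φ z) δ).indicator (fun ζ => F.1 ζ l * (g z * inner ℂ (F.1 z) u)) ζ := by
    intro ζ
    by_cases h : ζ ∈ Metric.ball (φ z) δ
    · rw [indicator_of_mem h, discKernel, if_pos (by simpa [dist_eq_norm] using h),
        inner_smul_right]
    · rw [indicator_of_notMem h, discKernel, if_neg (by simpa [dist_eq_norm] using h), zero_smul,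
        inner_zero_right, mul_zero]
  simp only [h1]
  rw [setIntegral_indicator measurableSet_ball, inter_eq_self_of_subset_right (hball z hz),
    integral_mul_const, setIntegral_ball_eq_of_differentiableOn
      ((differentiableOn_coord F l).mono (hcl _ hφS)) hδ, inner_smul_right]
  have : ((Real.pi * δ ^ 2 : ℝ) : ℂ) ≠ 0 := by
    exact_mod_cast (by positivity : Real.pi * δ ^ 2 ≠ 0)
  field_simp

/-- A weighted composition operator has bounded trace norm on the Bergman space. -/
theorem sum_norm_integral_inner_weightedComposition_le (hΩm : MeasurableSet Ω)
    (hΩ : volume Ω ≠ ⊤) (hSΩ : S ⊆ Ω) (hδ : 0 < δ)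
    (hball : ∀ z ∈ Ω, Metric.ball (φ z) δ ⊆ S) (hcl : ∀ ζ ∈ S, Metric.closedBall ζ δ ⊆ Ω)
    (hφ : Measurable φ) (hg : Measurable g) (hgM : ∀ z, ‖g z‖ ≤ M) {n : ℕ}
    {e : Fin n → bergmanSpace Ω N} (he : Orthonormal ℂ fun m => bergmanToLp Ω N (e m))
    (l : Fin N) (u : EuclideanSpace ℂ (Fin N)) (hu : ‖u‖ ≤ 1) :
    (∀ m, IntegrableOn (fun z => inner ℂ ((e m).1 z) ((g z * (e m).1 (φ z) l) • u)) Ω) ∧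
    ∑ m, ‖∫ z in Ω, inner ℂ ((e m).1 z) ((g z * (e m).1 (φ z) l) • u)‖ ≤
      M * volume.real Ω ^ 2 / (Real.pi * δ ^ 2) ^ 2 := by
  have hM : 0 ≤ M := (norm_nonneg _).trans (hgM 0)
  set V := volume.real Ω with hV
  have hV0 : 0 ≤ V := measureReal_nonneg
  set A := Real.pi * δ ^ 2 with hA
  have hA0 : 0 < A := by positivity
  have hint := fun m => integrable_discKernel (δ := δ) hΩ hSΩ hφ hg hgM (e m) l u
  have hpt := fun m z (hz : z ∈ Ω) =>
    weightedComposition_eq (g := g) hδ hball hcl (e m) l u hz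
  refine ⟨fun m => ?_, ?_⟩
  · refine IntegrableOn.congr_fun ?_ (fun z hz => (hpt m z hz).symm) hΩm
    exact (hint m).integral_prod_left.const_mul _
  set I : Fin n → ℂ → ℂ := fun m ζ =>
    (e m).1 ζ l * ∫ z in Ω, inner ℂ ((e m).1 z) (discKernel δ φ g z ζ • u) with hI
  -- After the swap the integrand at `ζ` is a coordinate of `e m` times the pairing of `e m` with a
  -- bounded function independent of `m`.
  have hswap : ∀ m, ∫ z in Ω, inner ℂ ((e m).1 z) ((g z * (e m).1 (φ z) l) • u)
      = (A : ℂ)⁻¹ * ∫ ζ in S, I m ζ := fun m => by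
    rw [setIntegral_congr_fun hΩm (hpt m), integral_const_mul, integral_integral_swap (hint m)]
    simp only [hI, hA, integral_const_mul]
  have hIint : ∀ m, Integrable (I m) (volume.restrict S) := fun m => by
    have := (hint m).integral_prod_right
    simpa only [hI, integral_const_mul] using this
  -- Cauchy–Schwarz in `m`: the two sums of squares are at most `V / A ^ 2` and `M ^ 2 * V`.
  have hbound : ∀ ζ ∈ S, ∑ m, ‖I m ζ‖ ≤ M * V / A := fun ζ hζ => by
    have h1 := sum_norm_sq_coord_le hΩ he hδ (hcl ζ hζ) l
    have h2 := sum_norm_sq_integral_inner_le hΩ he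
      (ψ := fun z => discKernel δ φ g z ζ • u)
      (((measurable_discKernel δ hφ hg).comp (measurable_id.prodMk
        measurable_const)).smul_const u).aestronglyMeasurable hM fun z => by
        rw [norm_smul]
        exact (mul_le_mul (norm_discKernel_le hgM z ζ) hu (norm_nonneg _) hM).trans (mul_one M).le
    simp only [hI, norm_mul]
    refine le_of_sq_le_sq ((Finset.sum_mul_sq_le_sq_mul_sq _ _ _).trans
      ((mul_le_mul h1 h2 (Finset.sum_nonneg fun _ _ => by positivity) (by positivity)).trans
        (le_of_eq ?_))) (by positivity)
    rw [← hV, ← hA]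
    field_simp
  have hSV : volume.real S ≤ V := measureReal_mono hSΩ hΩ
  calc ∑ m, ‖∫ z in Ω, inner ℂ ((e m).1 z) ((g z * (e m).1 (φ z) l) • u)‖
      = A⁻¹ * ∑ m, ‖∫ ζ in S, I m ζ‖ := by
        rw [Finset.mul_sum]
        refine Finset.sum_congr rfl fun m _ => ?_
        rw [hswap, norm_mul, norm_inv, Complex.norm_real, Real.norm_of_nonneg hA0.le]
    _ ≤ A⁻¹ * ∫ ζ in S, ∑ m, ‖I m ζ‖ := by
        rw [integral_finsetSum _ fun m _ => (hIint m).norm]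
        gcongr with m
        exact norm_integral_le_integral_norm _
    _ ≤ A⁻¹ * (M * V / A * volume.real S) := by
        gcongr
        refine (Real.le_norm_self _).trans (norm_setIntegral_le_of_norm_le_const
          ((measure_mono hSΩ).trans_lt hΩ.lt_top) fun ζ hζ => ?_)
        rw [Real.norm_of_nonneg (Finset.sum_nonneg fun _ _ => norm_nonneg _)]
        exact hbound ζ hζ
    _ ≤ A⁻¹ * (M * V / A * V) := by gcongr
    _ = M * V ^ 2 / A ^ 2 := by field_simp

end WeightedComposition

/-! ### Transfer operators and the counting bound. -/

theorem norm_permAction {N : ℕ} (σ : Equiv.Perm (Fin N)) (x : EuclideanSpace ℂ (Fin N)) :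
    ‖permAction σ x‖ = ‖x‖ := by
  have h : ∀ i, permAction σ x i = x (σ i) := fun i => by
    simp [permAction, Matrix.toLpLin_apply, Matrix.permMatrix_mulVec]
  rw [EuclideanSpace.norm_eq, EuclideanSpace.norm_eq]
  simp only [h]
  rw [Equiv.sum_comp σ fun i => ‖x i‖ ^ 2]

/-- The diagonal entries of the transfer operators in an orthonormal family are summable, with a
bound that is linear in the dimension `N`. -/
theorem exists_sum_norm_inner_transferOperator_le {d : ℕ} {Ω : Set ℂ} {γ : Fin d → ℂ → ℂ}
    {G : ℂ → ℂ} (h : IsAdmissible Ω γ G) :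
    ∃ C : ℝ, 0 ≤ C ∧ ∀ (N : ℕ) (σ : Fin d → Equiv.Perm (Fin N)) (n : ℕ)
      (e : Fin n → bergmanSpace Ω N), Orthonormal ℂ (fun m => bergmanToLp Ω N (e m)) →
      ∑ m, ‖inner ℂ (bergmanToLp Ω N (e m)) (bergmanToLp Ω N (transferOperator h σ (e m)))‖
        ≤ C * N := by
  have hΩ : volume Ω ≠ ⊤ := h.isBounded.measure_lt_top.ne
  have hΩm := h.isOpen.measurableSet
  classical
  set K : Set ℂ := ⋃ j, closure (γ j '' Ω) with hK
  have hKc : IsCompact K := isCompact_iUnion fun j =>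
    (h.isBounded.subset (h.mapsTo j).image_subset).isCompact_closure
  have hKΩ : K ⊆ Ω := iUnion_subset h.closure_image_subset
  have hγK : ∀ j, ∀ z ∈ Ω, γ j z ∈ K := fun j z hz =>
    mem_iUnion.2 ⟨j, subset_closure (mem_image_of_mem _ hz)⟩
  obtain ⟨ε, hε, hεΩ⟩ := hKc.exists_cthickening_subset_open h.isOpen hKΩ
  obtain ⟨M', hM'⟩ := hKc.exists_bound_of_continuousOn
    ((h.weight_differentiableOn.cexp).continuousOn.mono hKΩ)
  set M := max M' 0
  have hM : 0 ≤ M := le_max_right _ _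
  -- Half of `ε` goes to the thickening `S`, half to the discs centred in `S`.
  set δ := ε / 2 with hδdef
  have hδ : 0 < δ := by positivity
  set S := Metric.thickening δ K
  have hcl : ∀ ζ ∈ S, Metric.closedBall ζ δ ⊆ Ω := by
    intro ζ hζ x hx
    obtain ⟨k, hk, hζk⟩ := Metric.mem_thickening_iff.1 hζ
    refine hεΩ (Metric.mem_cthickening_of_dist_le x k ε K hk ?_)
    have := dist_triangle x ζ k
    rw [Metric.mem_closedBall] at hx
    linarith
  have hSΩ : S ⊆ Ω := fun ζ hζ => hcl ζ hζ (Metric.mem_closedBall_self hδ.le)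
  -- Extension by zero makes the maps and weights measurable on the whole plane and the weights
  -- globally bounded.
  set φ : Fin d → ℂ → ℂ := fun j => Ω.indicator (γ j) with hφdef
  set g : Fin d → ℂ → ℂ := fun j => Ω.indicator fun z => Complex.exp (G (γ j z)) with hgdef
  have hφ : ∀ j, Measurable (φ j) := fun j => by
    simp only [hφdef, ← piecewise_eq_indicator]
    exact (h.map_differentiableOn j).continuousOn.measurable_piecewise continuousOn_const hΩm
  have hg : ∀ j, Measurable (g j) := fun j => by
    simp only [hgdef, ← piecewise_eq_indicator]
    exact ((h.weight_differentiableOn.cexp.comp (h.map_differentiableOn j)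
      (h.mapsTo j)).continuousOn).measurable_piecewise continuousOn_const hΩm
  have hgM : ∀ j z, ‖g j z‖ ≤ M := fun j z => by
    by_cases hz : z ∈ Ω
    · simp only [hgdef, indicator_of_mem hz]
      exact (hM' _ (hγK j z hz)).trans (le_max_left _ _)
    · simpa only [hgdef, indicator_of_notMem hz, norm_zero] using hM
  have hball : ∀ j, ∀ z ∈ Ω, Metric.ball (φ j z) δ ⊆ S := fun j z hz => by
    simp only [hφdef, indicator_of_mem hz]
    exact Metric.ball_subset_thickening (hγK j z hz) δ
  set C' := M * volume.real Ω ^ 2 / (Real.pi * δ ^ 2) ^ 2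
  refine ⟨d * C', by positivity, fun N σ n e he => ?_⟩
  -- Expanding `F` in the standard basis splits the operator into `d * N` scalar weighted
  -- compositions, each with a fixed unit vector as direction.
  set u : Fin d → Fin N → EuclideanSpace ℂ (Fin N) := fun j l =>
    permAction (σ j) (EuclideanSpace.single l 1) with hu
  have hterm := fun j l => sum_norm_integral_inner_weightedComposition_le hΩm hΩ
    hSΩ hδ (hball j) hcl (hφ j) (hg j) (hgM j) he l (u j l) (by simp [hu, norm_permAction])
  have hpt : ∀ m, ∀ z ∈ Ω, inner ℂ ((e m).1 z) ((transferOperator h σ (e m)).1 z) =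
      ∑ j, ∑ l, inner ℂ ((e m).1 z) ((g j z * (e m).1 (φ j z) l) • u j l) := by
    intro m z hz
    have h1 : (transferOperator h σ (e m)).1 z
        = ∑ j, ∑ l, (g j z * (e m).1 (φ j z) l) • u j l := by
      change transferFun Ω γ G σ (e m).1 z = _
      rw [transferFun, indicator_of_mem hz]
      refine Finset.sum_congr rfl fun j _ => ?_
      simp only [hgdef, hφdef, indicator_of_mem hz, mul_smul, ← Finset.smul_sum, hu, ← map_smul,
        ← map_sum]
      congr 2
      ext i
      simp [Pi.single_apply]
    rw [h1, inner_sum]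
    exact Finset.sum_congr rfl fun j _ => inner_sum _ _ _
  have heq : ∀ m, inner ℂ (bergmanToLp Ω N (e m)) (bergmanToLp Ω N (transferOperator h σ (e m))) =
      ∑ j, ∑ l, ∫ z in Ω, inner ℂ ((e m).1 z) ((g j z * (e m).1 (φ j z) l) • u j l) := fun m => by
    rw [inner_bergmanToLp, setIntegral_congr_fun hΩm (hpt m), integral_finsetSum _ fun j _ =>
      integrable_finsetSum _ fun l _ => (hterm j l).1 m]
    exact Finset.sum_congr rfl fun j _ => integral_finsetSum _ fun l _ => (hterm j l).1 m
  calc ∑ m, ‖inner ℂ (bergmanToLp Ω N (e m)) (bergmanToLp Ω N (transferOperator h σ (e m)))‖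
      ≤ ∑ m, ∑ j, ∑ l,
        ‖∫ z in Ω, inner ℂ ((e m).1 z) ((g j z * (e m).1 (φ j z) l) • u j l)‖ := by
        refine Finset.sum_le_sum fun m _ => ?_
        rw [heq]
        exact (norm_sum_le _ _).trans (Finset.sum_le_sum fun j _ => norm_sum_le _ _)
    _ = ∑ j, ∑ l, ∑ m,
        ‖∫ z in Ω, inner ℂ ((e m).1 z) ((g j z * (e m).1 (φ j z) l) • u j l)‖ := by
        rw [Finset.sum_comm]
        exact Finset.sum_congr rfl fun j _ => Finset.sum_comm
    _ ≤ ∑ j : Fin d, ∑ l : Fin N, C' :=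
        Finset.sum_le_sum fun j _ => Finset.sum_le_sum fun l _ => (hterm j l).2
    _ = d * C' * N := by
        simp only [Finset.sum_const, Finset.card_univ, Fintype.card_fin, nsmul_eq_mul]
        ring

theorem theorem1p1 {d : ℕ} (Ω : Set ℂ) (γ : Fin d → ℂ → ℂ) (G : ℂ → ℂ)
    (h : IsAdmissible Ω γ G) :
    ∃ C₀ : ℝ, 0 < C₀ ∧
      ∀ (N : ℕ) (σ : Fin d → Equiv.Perm (Fin N)) (r : ℝ), 0 < r →
        ∃ n : ℕ, eigenvalueCount (transferOperator h σ) r⁻¹ = n ∧ (n : ℝ) ≤ C₀ * r * N := by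
  obtain ⟨C, hC, hsum⟩ := exists_sum_norm_inner_transferOperator_le h
  -- `C` may be zero, while the constant has to be positive.
  refine ⟨C + 1, by positivity, fun N σ r hr => ?_⟩
  have hle : eigenvalueCount (transferOperator h σ) r⁻¹ ≤ (⌊(C + 1) * r * N⌋₊ : ℕ) := by
    refine eigenvalueCount_le _ _ _ fun W hWf hWT hWc => Nat.le_floor ?_
    obtain ⟨e, he, hec⟩ := exists_orthonormal_le_norm_inner_of_invariant (bergmanToLp Ω N)
      (bergmanToLp_injective h.isOpen N) (transferOperator h σ) W hWT r⁻¹ hWc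
    have h1 : (Module.finrank ℂ W : ℝ) * r⁻¹ ≤ C * N := by
      refine le_trans ?_ (hsum N σ _ e he)
      simpa using Finset.card_nsmul_le_sum Finset.univ _ r⁻¹ fun m _ => hec m
    rw [← div_eq_mul_inv, div_le_iff₀ hr] at h1
    nlinarith [mul_nonneg hr.le (Nat.cast_nonneg (α := ℝ) N)]
  obtain ⟨n, hn⟩ := ENat.ne_top_iff_exists.1 (ne_top_of_le_ne_top (ENat.natCast_ne_top _) hle)
  refine ⟨n, hn.symm, ?_⟩
  rw [← hn] at hle
  exact (Nat.cast_le.2 (Nat.cast_le.1 hle)).trans (Nat.floor_le (by positivity))
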